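/- **Setting.** Let $X_\ell=\{x\in\mathbb Z^{p_\ell}\times\mathbb R^{q_\ell}: S_\ell x\le s_\ell\}$, $Z_\ell=\mathrm{conv}(X_\ell)$, $Z=Z_1\times\dots\times Z_m$, let $c$ be a cost vector, $A$ a matrix with $y$ rows, $b\in\mathbb R^y$, let $\rho\in\mathbb R^y$ be a tightening vector, and $g(z)=Az-b+\rho$. For $\alpha,\delta>0$ put $L_\kappa(z,\lambda)=c^Tz+\frac\alpha2\|z\|^2+\lambda^Tg(z)-\frac\delta2\|\lambda\|^2$, with saddle point $(\hat z_\kappa,\hat\lambda_\kappa)$ (minimum over $z\in Z$, maximum over $\lambda\in\mathbb R^y_{\ge0}$). Norms are Euclidean, and $\|A\|_2$ is the spectral norm. Assume: (1) $Z$ is nonempty and compact, $r=\max_{z\in Z}\|z\|$; (2) $\bar z\in Z$ satisfies $g_j(\bar z)<0$ for all $j$. Let $$\Lambda=\frac{c^T\bar z+\frac\alpha2\|\bar z\|^2+\|c\|\,r}{\min_{j}(-g_j(\bar z))},\qquad M=\{\lambda\ge0:\|\lambda\|_1\le\Lambda\}.$$ Partition $\lambda$ into blocks $\lambda_{[q]}$,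 one per dual agent, and let $M_q$ be the set of nonnegative vectors of the size of block $q$ with $1$-norm at most $\Lambda$. **Algorithm.** Let $z(0)\in Z$ and $\lambda(0)\in M$ be the common initial values, $\gamma,\beta>0$, $K^i\subseteq\mathbb N$ for each primal agent $i\in\{1,\dots,m\}$, $D\subseteq\{1,2,\dots\}$, and $B\ge1$ an integer. Agent $i$ stores a copy $(z^i(k),\lambda^i(k))$. If $k\in K^i$, then $z^i_{[i]}(k+1)=\Pi_{Z_i}[z^i_{[i]}(k)-\gamma\nabla_{z_{[i]}}L_\kappa(z^i(k),\lambda^i(k))]$; otherwise $z^i_{[i]}$ is held. For $j\ne i$, block $z^i_{[j]}(k+1)$ is either held or overwritten by a received value $z^j_{[j]}(\tau^i_j(k+1))$, where $\tau^i_j(k)$ is the time when agent $j$ computed the value that agent $i$ has at time $k$. All primal agents use the same current value $\lambda(k)$ of the dual blocks that they need. At the times $tB$, $t\in D$, each dual agent $q$ receives the current primal blocks that it needs and sets $\lambda_{[q]}(tB)=\Pi_{M_q}[\lambda_{[q]}(tB-1)+\beta\nabla_{\lambda_{[q]}}L_\kappa(z(tB),\lambda(tB-1))]$; at other times $\lambda$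 is held. Here $z(k)=(z^1_{[1]}(k),\dots,z^m_{[m]}(k))$. Assume (3), bounded delays: every $K^i$ meets $\{k,\dots,k+B-1\}$ for every $k$, and $k-B<\tau^i_j(k)\le k$ for all $j\ne i$ and $k\in K^i$. **Theorem (dual convergence).** Under (1) and (2), there are constants $\gamma_1,\theta>0$, depending only on the problem data, $\alpha$, $\bar z$ and $B$, such that for every $\gamma\in(0,\gamma_1)$ the number $q_p=1-\theta\gamma$ is in $[0,1)$ and for all $\delta>0$ the following holds. $L_\kappa$ has a unique saddle point $(\hat z_\kappa,\hat\lambda_\kappa)$. If $$0<\beta<\min\left\{\frac{2\alpha}{\|A\|_2+2\alpha\delta},\ \frac{2\delta}{1+\delta^2}\right\},$$ then $q_d=(1-\beta\delta)^2+\beta^2\in[0,1)$, and for every run of the algorithm that satisfies (3): (a) $q_p$ is a rate of convergence of the primal iterates between dual updates: if $t<t'$ are consecutive elements of $D\cup\{0\}$ and $\hat z(tB)$ minimizes $L_\kappa(\cdot,\lambda(tB))$ over $Z$, then $\|z(t'B)-\hat z(tB)\|\le q_p^{\,t'-t}\|z(tB)-\hat z(tB)\|$; (b) if $t_n$ is the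 $n$-th element of $D$, then $$\|\lambda(t_nB)-\hat\lambda_\kappa\|^2\le q_d^{\,n}\|\lambda(0)-\hat\lambda_\kappa\|^2+\left(4r^2q_dq_p^2\|A\|_2^2+8r^2\beta^2q_p\|A\|_2^2\right)\sum_{i=0}^nq_d^{\,i}.$$ -/

import Mathlib

open scoped Matrix.Norms.L2Operator

noncomputable section

/-! ### Vectors partitioned into blocks -/

/-- Real vectors with the Euclidean norm, partitioned into blocks indexed by `ι`; the entries of
block `i` are indexed by `κ i`. -/
abbrev BlockVec {ι : Type} (κ : ι → Type) : Type := EuclideanSpace ℝ (Σ i, κ i)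

section Blocks

variable {ι : Type} [DecidableEq ι] {κ : ι → Type}

/-- The `i`-th block of `x`. -/
def block (x : BlockVec κ) (i : ι) : EuclideanSpace ℝ (κ i) :=
  WithLp.toLp 2 fun a => x ⟨i, a⟩

/-- `x` with its `i`-th block replaced by `v`. -/
def replaceBlock (x : BlockVec κ) (i : ι) (v : EuclideanSpace ℝ (κ i)) : BlockVec κ :=
  WithLp.toLp 2 fun s => Function.update (fun j => block x j) i v s.1 s.2

/-- The vector whose `i`-th block at time `k` is the `i`-th block of the `i`-th agent's copy. -/
def assemble (w : ι → ℕ → BlockVec κ) (k : ℕ) : BlockVec κ :=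
  WithLp.toLp 2 fun s => w s.1 k s

end Blocks

/-- `p` is the Euclidean projection of `x` onto `S`, i.e. a nearest point of `S` (it is unique
when `S` is convex). -/
def IsProj {E : Type} [NormedAddCommGroup E] (S : Set E) (x p : E) : Prop :=
  p ∈ S ∧ ∀ w ∈ S, ‖x - p‖ ≤ ‖x - w‖

/-! ### The problem -/

/-- Data of a mixed-integer linear program over `m` primal agents; primal agent `l` has `p l`
integer and `q l` real variables. The coupling constraints are partitioned among `h` dual
agents, dual agent `d` being in charge of `rows d` of them. -/
structure MILP (m h : ℕ) where
  p : Fin m → ℕ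
  q : Fin m → ℕ
  rows : Fin h → ℕ
  /-- number of local constraints of each agent -/
  v : ℕ
  /-- the cost vector -/
  c : BlockVec fun l => Fin (p l) ⊕ Fin (q l)
  /-- the coupling matrix -/
  A : Matrix (Σ d, Fin (rows d)) (Σ l, Fin (p l) ⊕ Fin (q l)) ℝ
  b : BlockVec fun d => Fin (rows d)
  /-- the local constraint matrices and right-hand sides -/
  S : (l : Fin m) → Matrix (Fin v) (Fin (p l) ⊕ Fin (q l)) ℝ
  s : Fin m → Fin v → ℝ

namespace MILP

variable {m h : ℕ} (P : MILP m h)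

/-- The space of primal variables. -/
abbrev Primal : Type := BlockVec fun l => Fin (P.p l) ⊕ Fin (P.q l)

/-- The space of dual variables. -/
abbrev Dual : Type := BlockVec fun d => Fin (P.rows d)

/-- The mixed-integer set of agent `l`. -/
def X (l : Fin m) : Set (EuclideanSpace ℝ (Fin (P.p l) ⊕ Fin (P.q l))) :=
  {x | (∀ a : Fin (P.p l), ∃ n : ℤ, x (Sum.inl a) = n) ∧
    ∀ e : Fin P.v, (P.S l).mulVec x.ofLp e ≤ P.s l e}

/-- The convex hull of the mixed-integer set of agent `l`. -/
def Zblock (l : Fin m) : Set (EuclideanSpace ℝ (Fin (P.p l) ⊕ Fin (P.q l))) :=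
  convexHull ℝ (P.X l)

/-- The product of the sets `Zblock l`. -/
def Z : Set P.Primal := {z | ∀ l, block z l ∈ P.Zblock l}

/-- The largest Euclidean norm on `Z`. -/
def radius : ℝ := sSup ((fun z : P.Primal => ‖z‖) '' P.Z)

/-- The spectral norm of the coupling matrix. -/
def normA : ℝ := ‖P.A‖

/-- The coupling constraint function `g z = A z - b + ρ`, tightened by `ρ`. -/
def g (ρ : P.Dual) (z : P.Primal) : P.Dual :=
  WithLp.toLp 2 (P.A.mulVec z.ofLp) - P.b + ρ

/-- `zbar` is a Slater point: it lies in `Z` and satisfies all coupling constraints strictly. -/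
def IsSlater (ρ : P.Dual) (zbar : P.Primal) : Prop :=
  zbar ∈ P.Z ∧ ∀ j, P.g ρ zbar j < 0

/-- The regularized Lagrangian. -/
def L (ρ : P.Dual) (α δ : ℝ) (z : P.Primal) (lam : P.Dual) : ℝ :=
  inner ℝ P.c z + α / 2 * ‖z‖ ^ 2 + inner ℝ lam (P.g ρ z) - δ / 2 * ‖lam‖ ^ 2

/-- Partial gradient of the regularized Lagrangian in the `i`-th primal block. -/
def gradPrimal (ρ : P.Dual) (α δ : ℝ) (i : Fin m) (z : P.Primal) (lam : P.Dual) :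
    EuclideanSpace ℝ (Fin (P.p i) ⊕ Fin (P.q i)) :=
  gradient (fun v => P.L ρ α δ (replaceBlock z i v) lam) (block z i)

/-- Partial gradient of the regularized Lagrangian in the `d`-th dual block. -/
def gradDual (ρ : P.Dual) (α δ : ℝ) (d : Fin h) (z : P.Primal) (lam : P.Dual) :
    EuclideanSpace ℝ (Fin (P.rows d)) :=
  gradient (fun v => P.L ρ α δ z (replaceBlock lam d v)) (block lam d)

/-- `(zhat, lamhat)` is a saddle point of the regularized Lagrangian: minimum over `Z`, maximum
over the nonnegative orthant. -/
def IsSaddle (ρ : P.Dual) (α δ : ℝ) (zhat : P.Primal) (lamhat : P.Dual) : Prop :=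
  zhat ∈ P.Z ∧ (∀ j, 0 ≤ lamhat j) ∧
  (∀ z ∈ P.Z, P.L ρ α δ zhat lamhat ≤ P.L ρ α δ z lamhat) ∧
  (∀ lam : P.Dual, (∀ j, 0 ≤ lam j) → P.L ρ α δ zhat lam ≤ P.L ρ α δ zhat lamhat)

/-- The bound on the `1`-norm of the multipliers given by the Slater point `zbar`. -/
def dualBound (ρ : P.Dual) (α : ℝ) (zbar : P.Primal) : ℝ :=
  (inner ℝ P.c zbar + α / 2 * ‖zbar‖ ^ 2 + ‖P.c‖ * P.radius) / ⨅ j, -(P.g ρ zbar j)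

/-- The set `M` of dual variables. -/
def M (ρ : P.Dual) (α : ℝ) (zbar : P.Primal) : Set P.Dual :=
  {lam | (∀ j, 0 ≤ lam j) ∧ ∑ j, |lam j| ≤ P.dualBound ρ α zbar}

/-- The set onto which dual agent `d` projects its block. -/
def Mblock (ρ : P.Dual) (α : ℝ) (zbar : P.Primal) (d : Fin h) :
    Set (EuclideanSpace ℝ (Fin (P.rows d))) :=
  {x | (∀ j, 0 ≤ x j) ∧ ∑ j, |x j| ≤ P.dualBound ρ α zbar}

/-- The variables of primal agent `l` appear in a constraint of dual agent `d`; only then do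
these two agents have to communicate. -/
def Coupled (d : Fin h) (l : Fin m) : Prop :=
  ∃ (e : Fin (P.rows d)) (a : Fin (P.p l) ⊕ Fin (P.q l)), P.A ⟨d, e⟩ ⟨l, a⟩ ≠ 0

end MILP

/-! ### The asynchronous algorithm -/

/-- The timing of computations and communications. -/
structure Schedule (m : ℕ) where
  /-- times at which primal agent `i` updates its block -/
  K : Fin m → Set ℕ
  /-- the dual agents update at the times `t * B`, `t ∈ D` -/
  D : Set ℕ
  D_pos : ∀ t ∈ D, 0 < t
  /-- times at which primal agent `i` receives the block of primal agent `j` -/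
  R : Fin m → Fin m → Set ℕ
  /-- time at which agent `j` computed the value of block `j` that agent `i` has at time `k` -/
  τ : Fin m → Fin m → ℕ → ℕ
  τ_zero : ∀ i j, τ i j 0 = 0
  τ_le : ∀ i j k, τ i j k ≤ k
  τ_hold : ∀ i j k, k ∉ R i j → τ i j (k + 1) = τ i j k

/-- Bounded delays (partial asynchrony): every primal agent updates at least once in any `B`
consecutive steps, and the values of other blocks that it uses when it updates are less than
`B` steps old. -/
def Schedule.BoundedDelays {m : ℕ} (σ : Schedule m) (B : ℕ) : Prop :=
  (∀ i k, ∃ k' ∈ σ.K i, k ≤ k' ∧ k' < k + B) ∧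
  (∀ i j, j ≠ i → ∀ k ∈ σ.K i, k < σ.τ i j k + B ∧ σ.τ i j k ≤ k)

/-- `t` is the `n`-th entry of `D` (counting from one). -/
def IsNthEntry (D : Set ℕ) (n t : ℕ) : Prop :=
  t ∈ D ∧ {s | s ∈ D ∧ s ≤ t}.ncard = n

/-- `t < t'` are consecutive dual update indices (or `t` is the start, time zero, and `t'` is the
first dual update index). -/
def ConsecutiveUpdates (D : Set ℕ) (t t' : ℕ) : Prop :=
  (t = 0 ∨ t ∈ D) ∧ t' ∈ D ∧ t < t' ∧ ∀ s ∈ D, ¬ (t < s ∧ s < t')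

/-- The values stored onboard the agents at all times. -/
structure Trajectory {m h : ℕ} (P : MILP m h) where
  /-- primal copy of primal agent `i` at time `k` -/
  zP : Fin m → ℕ → P.Primal
  /-- dual copy of primal agent `i` at time `k` -/
  lamP : Fin m → ℕ → P.Dual
  /-- primal copy of dual agent `d` at time `k` -/
  zD : Fin h → ℕ → P.Primal
  /-- dual copy of dual agent `d` at time `k` -/
  lamD : Fin h → ℕ → P.Dual

namespace Trajectory

variable {m h : ℕ} {P : MILP m h}

/-- The true primal iterate: the `i`-th block is the one stored by primal agent `i`. -/
def z (T : Trajectory P) (k : ℕ) : P.Primal := assemble T.zP k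

/-- The true dual iterate: the `d`-th block is the one stored by dual agent `d`. -/
def lam (T : Trajectory P) (k : ℕ) : P.Dual := assemble T.lamD k

/-- The trajectory is generated by the asynchronous projected gradient descent-ascent algorithm
with primal step size `γ` and dual step size `β`. -/
structure IsRun (T : Trajectory P) (σ : Schedule m) (ρ : P.Dual) (zbar : P.Primal)
    (α δ γ β : ℝ) (B : ℕ) : Prop where
  init_primal : T.z 0 ∈ P.Z
  init_copies : ∀ i, T.zP i 0 = T.z 0
  init_dual : T.lam 0 ∈ P.M ρ α zbar
  /-- primal agent `i` updates its block by projected gradient descent at the times in `K i` -/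
  primal_update : ∀ i, ∀ k ∈ σ.K i,
    IsProj (P.Zblock i)
      (block (T.zP i k) i - γ • P.gradPrimal ρ α δ i (T.zP i k) (T.lamP i k))
      (block (T.zP i (k + 1)) i)
  primal_hold : ∀ i k, k ∉ σ.K i → block (T.zP i (k + 1)) i = block (T.zP i k) i
  /-- a received block overwrites the old value -/
  receive : ∀ i j, j ≠ i → ∀ k ∈ σ.R i j,
    block (T.zP i (k + 1)) j = block (T.zP j (σ.τ i j (k + 1))) j
  no_receive : ∀ i j, j ≠ i → ∀ k, k ∉ σ.R i j →
    block (T.zP i (k + 1)) j = block (T.zP i k) j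
  /-- all primal agents use the same, current, values of the dual blocks that they need -/
  dual_agreement : ∀ i d, P.Coupled d i → ∀ k, block (T.lamP i k) d = block (T.lamD d k) d
  /-- before a dual update, primal agents send their current blocks to the dual agents that
  need them -/
  dual_receive : ∀ d j, P.Coupled d j → ∀ t ∈ σ.D,
    block (T.zD d (t * B)) j = block (T.zP j (t * B)) j
  /-- projected gradient ascent at the times `t * B`, `t ∈ D` -/
  dual_update : ∀ d k, ∀ t ∈ σ.D, k + 1 = t * B →
    IsProj (P.Mblock ρ α zbar d)
      (block (T.lamD d k) d + β • P.gradDual ρ α δ d (T.zD d (k + 1)) (T.lamD d k))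
      (block (T.lamD d (k + 1)) d)
  dual_hold : ∀ d k, (∀ t ∈ σ.D, k + 1 ≠ t * B) →
    block (T.lamD d (k + 1)) d = block (T.lamD d k) d

end Trajectory

end

/-! The regularization `α / 2 * ‖z‖ ^ 2` is separable and the remaining terms are affine in z, so
the partial gradient in block i involves only that block and the multipliers of the constraints it
enters (`gradPrimal_eq`, `block_dz`). Delays between primal agents therefore do no harm: while λ is
fixed, each update contracts the distance of its block to the minimizer by `1 - α * γ`, and a window
of length `B` contains an update of every block. This gives θ = α.

For the dual, the Slater point bounds the saddle multiplier, so each of its blocks lies in the set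
projected onto and is a fixed point of the exact dual step. Nonexpansiveness of projections
(`norm_dual_step`) bounds the new error by the norm of (1 - βδ)Δ + βA(z - ẑ), where Δ is the old
dual error. After squaring, the cross term is split at the exact minimizer for the current λ: one
part is nonpositive by strong convexity (`inner_coupling_le_of_isMin`), the other is controlled by
the primal contraction and Young's inequality. The resulting recursion with rate (1 - βδ)² + β²
(`norm_sq_dual_le`) is iterated over the entries of D. -/

noncomputable section

/-! ### Projections, first-order conditions and gradients. -/

section General

variable {E : Type} [NormedAddCommGroup E] [InnerProductSpace ℝ E]

theorem IsProj.inner_le_zero {S : Set E} (hS : Convex ℝ S) {x p w : E} (hp : IsProj S x p)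
    (hw : w ∈ S) : inner ℝ (x - p) (w - p) ≤ 0 := by
  refine (norm_eq_iInf_iff_real_inner_le_zero hS hp.1).1 ?_ w hw
  have : Nonempty S := ⟨⟨p, hp.1⟩⟩
  refine le_antisymm (le_ciInf fun w => hp.2 w w.2) ?_
  exact ciInf_le (f := fun w : S => ‖x - w‖) ⟨0, by rintro _ ⟨w, rfl⟩; exact norm_nonneg _⟩
    ⟨p, hp.1⟩

/-- Nonexpansiveness of projection, with the second point given by its variational inequality, the
form in which optimality conditions supply it. -/
theorem IsProj.norm_sub_le {S : Set E} (hS : Convex ℝ S) {x p x' p' : E} (hp : IsProj S x p)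
    (hp' : p' ∈ S) (h : ∀ w ∈ S, inner ℝ (x' - p') (w - p') ≤ 0) : ‖p - p'‖ ≤ ‖x - x'‖ := by
  have h1 := hp.inner_le_zero hS hp'
  have h2 := h p hp.1
  have h3 : inner ℝ (x - p) (p' - p) + inner ℝ (x' - p') (p - p') =
      inner ℝ (p - p') (p - p') - inner ℝ (x - x') (p - p') := by
    simp only [inner_sub_left, inner_sub_right]; ring
  have h4 := real_inner_le_norm (x - x') (p - p')
  rw [real_inner_self_eq_norm_sq] at h3
  nlinarith [norm_nonneg (p - p'), norm_nonneg (x - x')]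

theorem nonneg_of_forall_mul_add_sq_mul_nonneg {a b : ℝ}
    (h : ∀ t : ℝ, 0 < t → t ≤ 1 → 0 ≤ t * a + t ^ 2 * b) : 0 ≤ a := by
  by_contra! ha
  have hpos : 0 < |b| - a := by linarith [abs_nonneg b]
  -- This t solves a + t|b| = ta, which is negative when a < 0.
  set t := -a / (|b| - a) with ht
  have ht0 : 0 < t := div_pos (by linarith) hpos
  have ht1 : t ≤ 1 := (div_le_one hpos).2 (by linarith [abs_nonneg b])
  have h1 := h t ht0 ht1
  have h2 : t * (|b| - a) = -a := div_mul_cancel₀ _ hpos.ne'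
  nlinarith [le_abs_self b, mul_pos ht0 ht0, mul_pos (mul_pos ht0 ht0) (neg_pos.2 ha),
    mul_nonneg (mul_pos ht0 ht0).le (sub_nonneg.2 (le_abs_self b))]

theorem gradient_const_add_inner_add_mul_norm_sq [CompleteSpace E] (C a : ℝ) (w x : E) :
    gradient (fun v : E => C + inner ℝ w v + a * ‖v‖ ^ 2) x = w + (2 * a) • x := by
  apply HasGradientAt.gradient
  rw [hasGradientAt_iff_hasFDerivAt]
  have h1 : HasFDerivAt (fun v : E => inner ℝ w v) (innerSL ℝ w) x :=
    (innerSL ℝ w).hasFDerivAt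
  have h2 := (hasStrictFDerivAt_norm_sq x).hasFDerivAt.const_mul a
  refine ((h1.const_add C).add h2).congr_fderiv ?_
  ext v
  simp
  ring

end General

/-! ### Inner products and norms of block vectors. -/

section Blocks

variable {ι : Type} {κ : ι → Type}

theorem block_replaceBlock [DecidableEq ι] (x : BlockVec κ) (i : ι) (v : EuclideanSpace ℝ (κ i))
    (j : ι) :
    block (replaceBlock x i v) j = Function.update (fun j => block x j) i v j := rfl

variable [Fintype ι] [∀ i, Fintype (κ i)]

theorem inner_eq_sum_block (x y : BlockVec κ) :
    inner ℝ x y = ∑ i, inner ℝ (block x i) (block y i) := by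
  simp [PiLp.inner_apply, Fintype.sum_sigma, block]

theorem norm_sq_eq_sum_block (x : BlockVec κ) : ‖x‖ ^ 2 = ∑ i, ‖block x i‖ ^ 2 := by
  simp only [← real_inner_self_eq_norm_sq, inner_eq_sum_block x x]

theorem norm_le_of_forall_block_le {x y : BlockVec κ} {C : ℝ} (hC : 0 ≤ C)
    (h : ∀ i, ‖block x i‖ ≤ C * ‖block y i‖) : ‖x‖ ≤ C * ‖y‖ := by
  refine le_of_sq_le_sq ?_ (by positivity)
  rw [mul_pow, norm_sq_eq_sum_block, norm_sq_eq_sum_block y, Finset.mul_sum]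
  refine Finset.sum_le_sum fun i _ => ?_
  rw [← mul_pow]
  exact pow_le_pow_left₀ (norm_nonneg _) (h i) 2

variable [DecidableEq ι]

theorem inner_replaceBlock (x z : BlockVec κ) (i : ι) (v : EuclideanSpace ℝ (κ i)) :
    inner ℝ x (replaceBlock z i v) = inner ℝ x z + inner ℝ (block x i) (v - block z i) := by
  rw [inner_eq_sum_block, inner_eq_sum_block x z, ← Finset.add_sum_erase _ _ (Finset.mem_univ i),
    ← Finset.add_sum_erase _ (fun j => inner ℝ (block x j) (block z j)) (Finset.mem_univ i)]
  have : ∑ j ∈ Finset.univ.erase i, inner ℝ (block x j) (block (replaceBlock z i v) j) =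
      ∑ j ∈ Finset.univ.erase i, inner ℝ (block x j) (block z j) := by
    refine Finset.sum_congr rfl fun j hj => ?_
    rw [block_replaceBlock, Function.update_of_ne (Finset.ne_of_mem_erase hj)]
  rw [this, block_replaceBlock, Function.update_self, inner_sub_right]
  ring

theorem norm_sq_replaceBlock (z : BlockVec κ) (i : ι) (v : EuclideanSpace ℝ (κ i)) :
    ‖replaceBlock z i v‖ ^ 2 = ‖z‖ ^ 2 - ‖block z i‖ ^ 2 + ‖v‖ ^ 2 := by
  rw [← real_inner_self_eq_norm_sq, inner_replaceBlock, real_inner_comm, inner_replaceBlock,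
    block_replaceBlock, Function.update_self]
  simp only [inner_sub_right, ← real_inner_self_eq_norm_sq]
  rw [real_inner_comm v (block z i)]
  ring

end Blocks

/-! ### Derivatives and minimizers of the regularized Lagrangian. -/

namespace MILP

variable {m h : ℕ} (P : MILP m h)

/-- The coupling matrix as a linear map. -/
def coupling : P.Primal →ₗ[ℝ] P.Dual := Matrix.toLpLin 2 2 P.A

/-- The transposed coupling matrix as a linear map. -/
def couplingT : P.Dual →ₗ[ℝ] P.Primal := Matrix.toLpLin 2 2 P.A.transpose

/-- The gradient of the regularized Lagrangian in the primal variables. -/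
def dz (α : ℝ) (z : P.Primal) (lam : P.Dual) : P.Primal := P.c + α • z + P.couplingT lam

variable {P}

theorem g_eq (ρ : P.Dual) (z : P.Primal) : P.g ρ z = P.coupling z - P.b + ρ := rfl

theorem g_sub (ρ : P.Dual) (z w : P.Primal) : P.g ρ z - P.g ρ w = P.coupling (z - w) := by
  rw [g_eq, g_eq, map_sub]; abel

theorem inner_coupling (lam : P.Dual) (z : P.Primal) :
    inner ℝ lam (P.coupling z) = inner ℝ (P.couplingT lam) z := by
  simp only [coupling, couplingT, EuclideanSpace.inner_eq_star_dotProduct, Matrix.toLpLin_apply,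
    star_trivial]
  rw [dotProduct_comm, Matrix.dotProduct_mulVec, Matrix.mulVec_transpose, dotProduct_comm]

theorem norm_coupling_le (z : P.Primal) : ‖P.coupling z‖ ≤ P.normA * ‖z‖ :=
  Matrix.l2_opNorm_mulVec P.A z

/-- As a function of one block, the Lagrangian is a constant plus a linear term plus `α / 2 * ‖v‖ ^
2`; the other primal blocks enter only the constant. -/
theorem gradPrimal_eq (ρ : P.Dual) (α δ : ℝ) (i : Fin m) (z : P.Primal) (lam : P.Dual) :
    P.gradPrimal ρ α δ i z lam = block (P.dz α z lam) i := by
  unfold gradPrimal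
  have : (fun v => P.L ρ α δ (replaceBlock z i v) lam) = fun v =>
      (inner ℝ (P.c + P.couplingT lam) z - inner ℝ (block (P.c + P.couplingT lam) i) (block z i) +
        α / 2 * (‖z‖ ^ 2 - ‖block z i‖ ^ 2) + inner ℝ lam (ρ - P.b) - δ / 2 * ‖lam‖ ^ 2) +
      inner ℝ (block (P.c + P.couplingT lam) i) v + α / 2 * ‖v‖ ^ 2 := by
    funext v
    have h1 := inner_replaceBlock (P.c + P.couplingT lam) z i v
    rw [inner_sub_right, inner_add_left, ← inner_coupling] at h1
    rw [L, norm_sq_replaceBlock, g_eq, inner_add_right, inner_sub_right, inner_sub_right]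
    linarith
  rw [this, gradient_const_add_inner_add_mul_norm_sq]
  ext a
  simp [block, dz]
  ring

theorem gradDual_eq (ρ : P.Dual) (α δ : ℝ) (d : Fin h) (z : P.Primal) (lam : P.Dual) :
    P.gradDual ρ α δ d z lam = block (P.g ρ z - δ • lam) d := by
  unfold gradDual
  have : (fun v => P.L ρ α δ z (replaceBlock lam d v)) = fun v =>
      (inner ℝ P.c z + α / 2 * ‖z‖ ^ 2 + inner ℝ (P.g ρ z) lam
        - inner ℝ (block (P.g ρ z) d) (block lam d)
        - δ / 2 * (‖lam‖ ^ 2 - ‖block lam d‖ ^ 2)) +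
      inner ℝ (block (P.g ρ z) d) v + (-(δ / 2)) * ‖v‖ ^ 2 := by
    funext v
    rw [L, norm_sq_replaceBlock, real_inner_comm (P.g ρ z), inner_replaceBlock, inner_sub_right]
    ring
  rw [this, gradient_const_add_inner_add_mul_norm_sq]
  ext a
  simp [block]
  ring

/-- The Lagrangian is quadratic in z, so its second-order expansion is exact. Both directions of the
first-order characterization of minimizers rest on it. -/
theorem L_add_smul (ρ : P.Dual) (α δ : ℝ) (z d : P.Primal) (lam : P.Dual) (t : ℝ) :
    P.L ρ α δ (z + t • d) lam =
      P.L ρ α δ z lam + t * inner ℝ (P.dz α z lam) d + t ^ 2 * (α / 2 * ‖d‖ ^ 2) := by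
  simp only [L, g_eq, dz, map_add, map_smul, inner_add_right, inner_sub_right, inner_add_left,
    inner_smul_right, inner_smul_left, ← inner_coupling, norm_add_sq_real, norm_smul,
    Real.norm_eq_abs, mul_pow, sq_abs, conj_trivial]
  ring

theorem convex_Z : Convex ℝ P.Z := fun _ hx _ hy _ _ ha hb hab l =>
  convex_convexHull ℝ (P.X l) (hx l) (hy l) ha hb hab

theorem add_smul_sub_mem_Z {z w : P.Primal} (hz : z ∈ P.Z) (hw : w ∈ P.Z) {t : ℝ} (h0 : 0 ≤ t)
    (h1 : t ≤ 1) : z + t • (w - z) ∈ P.Z :=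
  convex_Z.add_smul_sub_mem hz hw ⟨h0, h1⟩

theorem inner_dz_nonneg_of_isMin {ρ : P.Dual} {α δ : ℝ} {z w : P.Primal} {lam : P.Dual}
    (hz : z ∈ P.Z) (hmin : ∀ w ∈ P.Z, P.L ρ α δ z lam ≤ P.L ρ α δ w lam) (hw : w ∈ P.Z) :
    0 ≤ inner ℝ (P.dz α z lam) (w - z) := by
  refine nonneg_of_forall_mul_add_sq_mul_nonneg (b := α / 2 * ‖w - z‖ ^ 2) fun t h0 h1 => ?_
  have := hmin _ (add_smul_sub_mem_Z hz hw h0.le h1)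
  rw [L_add_smul] at this
  linarith

theorem continuous_coupling : Continuous P.coupling := P.coupling.continuous_of_finiteDimensional

theorem continuous_L (ρ : P.Dual) (α δ : ℝ) (lam : P.Dual) :
    Continuous fun z => P.L ρ α δ z lam := by
  have := P.continuous_coupling
  simp only [L, g_eq]
  fun_prop

theorem exists_isMin {ρ : P.Dual} {α δ : ℝ} (hZne : P.Z.Nonempty) (hZc : IsCompact P.Z)
    (lam : P.Dual) : ∃ z ∈ P.Z, ∀ w ∈ P.Z, P.L ρ α δ z lam ≤ P.L ρ α δ w lam :=
  hZc.exists_isMinOn hZne (continuous_L ρ α δ lam).continuousOn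

theorem norm_le_radius (hZc : IsCompact P.Z) {z : P.Primal} (hz : z ∈ P.Z) : ‖z‖ ≤ P.radius :=
  le_csSup (hZc.image continuous_norm).bddAbove ⟨z, hz, rfl⟩

theorem norm_sub_le_radius (hZc : IsCompact P.Z) {z w : P.Primal} (hz : z ∈ P.Z) (hw : w ∈ P.Z) :
    ‖z - w‖ ≤ 2 * P.radius := by
  linarith [_root_.norm_sub_le z w, norm_le_radius hZc hz, norm_le_radius hZc hw]

end MILP

/-! ### Saddle points: uniqueness, existence and the multiplier bound. -/

namespace MILP

variable {m h : ℕ} {P : MILP m h} {ρ : P.Dual} {α δ : ℝ}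

theorem isMin_of_inner_dz_nonneg (hα : 0 ≤ α) {z : P.Primal} {lam : P.Dual}
    (hz : ∀ w ∈ P.Z, 0 ≤ inner ℝ (P.dz α z lam) (w - z)) {w : P.Primal} (hw : w ∈ P.Z) :
    P.L ρ α δ z lam ≤ P.L ρ α δ w lam := by
  have h1 := L_add_smul ρ α δ z (w - z) lam 1
  rw [one_smul, add_sub_cancel] at h1
  have h2 := hz w hw
  have : 0 ≤ α / 2 * ‖w - z‖ ^ 2 := by positivity
  linarith

theorem L_dual_add_smul (z : P.Primal) (lam d : P.Dual) (t : ℝ) :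
    P.L ρ α δ z (lam + t • d) =
      P.L ρ α δ z lam + t * inner ℝ (P.g ρ z - δ • lam) d - t ^ 2 * (δ / 2 * ‖d‖ ^ 2) := by
  simp only [L, inner_add_left, inner_sub_left,
    inner_smul_left, norm_add_sq_real, norm_smul, inner_smul_right,
    Real.norm_eq_abs, mul_pow, sq_abs, conj_trivial, real_inner_comm d (P.g ρ z)]
  ring

theorem IsSaddle.inner_dual_nonpos {z : P.Primal} {lam mu : P.Dual}
    (hs : P.IsSaddle ρ α δ z lam) (hmu : ∀ j, 0 ≤ mu j) :
    inner ℝ (P.g ρ z - δ • lam) (mu - lam) ≤ 0 := by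
  rw [← neg_nonneg]
  refine nonneg_of_forall_mul_add_sq_mul_nonneg (b := δ / 2 * ‖mu - lam‖ ^ 2) fun t h0 h1 => ?_
  have := hs.2.2.2 (lam + t • (mu - lam)) fun j => by
    have h2 := hs.2.1 j
    have h3 := hmu j
    simp only [PiLp.add_apply, PiLp.smul_apply, PiLp.sub_apply, smul_eq_mul]
    nlinarith
  rw [L_dual_add_smul] at this
  linarith

/-- Add the first-order conditions of the two minimizers, each tested at the other. This is strong
concavity of the dual function in disguise; it serves both uniqueness of the saddle point and the
sign of the cross term in the dual recursion. -/
theorem inner_coupling_le_of_isMin {z w : P.Primal} {lam mu : P.Dual}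
    (hz : z ∈ P.Z) (hzmin : ∀ v ∈ P.Z, P.L ρ α δ z lam ≤ P.L ρ α δ v lam)
    (hw : w ∈ P.Z) (hwmin : ∀ v ∈ P.Z, P.L ρ α δ w mu ≤ P.L ρ α δ v mu) :
    inner ℝ (lam - mu) (P.coupling (z - w)) ≤ -(α * ‖z - w‖ ^ 2) := by
  have a1 := inner_dz_nonneg_of_isMin hz hzmin hw
  have a2 := inner_dz_nonneg_of_isMin hw hwmin hz
  have e1 : inner ℝ (P.dz α z lam) (w - z) + inner ℝ (P.dz α w mu) (z - w) =
      -(α * ‖z - w‖ ^ 2) - inner ℝ (lam - mu) (P.coupling (z - w)) := by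
    rw [inner_coupling, ← real_inner_self_eq_norm_sq]
    simp only [dz, map_sub, inner_add_left, inner_sub_left, inner_sub_right, inner_smul_left,
      conj_trivial]
    ring
  linarith

theorem IsSaddle.eq (hα : 0 < α) (hδ : 0 < δ) {z w : P.Primal} {lam mu : P.Dual}
    (h1 : P.IsSaddle ρ α δ z lam) (h2 : P.IsSaddle ρ α δ w mu) : z = w ∧ lam = mu := by
  have a := inner_coupling_le_of_isMin h1.1 h1.2.2.1 h2.1 h2.2.2.1
  have b1 := h1.inner_dual_nonpos h2.2.1
  have b2 := h2.inner_dual_nonpos h1.2.1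
  have key : α * ‖z - w‖ ^ 2 + δ * ‖lam - mu‖ ^ 2 ≤ 0 := by
    -- The coupling term here cancels the one from the primal conditions, leaving only the two
    -- regularization terms.
    have e2 : inner ℝ (P.g ρ z - δ • lam) (mu - lam) + inner ℝ (P.g ρ w - δ • mu) (lam - mu) =
        δ * ‖lam - mu‖ ^ 2 - inner ℝ (lam - mu) (P.coupling (z - w)) := by
      rw [← g_sub ρ, real_inner_comm (P.g ρ z - P.g ρ w), ← real_inner_self_eq_norm_sq]
      simp only [inner_sub_left, inner_sub_right, inner_smul_left, conj_trivial]
      ring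
    linarith
  have hz : 0 ≤ α * ‖z - w‖ ^ 2 := by positivity
  have hl : 0 ≤ δ * ‖lam - mu‖ ^ 2 := by positivity
  constructor
  · have : α * ‖z - w‖ ^ 2 = 0 := by linarith
    simpa [hα.ne', sub_eq_zero] using this
  · have : δ * ‖lam - mu‖ ^ 2 = 0 := by linarith
    simpa [hδ.ne', sub_eq_zero] using this

/-- No minimax theorem is needed: for fixed z the maximum of the Lagrangian over λ ≥ 0 is the
explicit penalty function `ψ`, attained at g⁺/δ. A minimizer of `ψ` over Z, with this multiplier, is
a saddle point. -/
theorem exists_isSaddle (hα : 0 < α) (hδ : 0 < δ) (hZne : P.Z.Nonempty) (hZc : IsCompact P.Z) :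
    ∃ z lam, P.IsSaddle ρ α δ z lam := by
  let ψ : P.Primal → ℝ := fun z =>
    inner ℝ P.c z + α / 2 * ‖z‖ ^ 2 + (2 * δ)⁻¹ * ∑ j, max (P.g ρ z j) 0 ^ 2
  have hψ : Continuous ψ := by
    have := P.continuous_coupling
    simp only [ψ, g_eq]
    fun_prop
  obtain ⟨z, hz, hmin⟩ := hZc.exists_isMinOn hZne hψ.continuousOn
  let lam : P.Dual := WithLp.toLp 2 fun j => max (P.g ρ z j) 0 / δ
  refine ⟨z, lam, hz, fun j => by simp only [lam]; positivity, fun w hw => ?_, fun mu hmu => ?_⟩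
  · refine isMin_of_inner_dz_nonneg hα.le (fun w hw => ?_) hw
    set d := w - z with hd
    refine nonneg_of_forall_mul_add_sq_mul_nonneg
      (b := α / 2 * ‖d‖ ^ 2 + (2 * δ)⁻¹ * ∑ j, P.coupling d j ^ 2) fun t h0 h1 => ?_
    have h2 : ψ z ≤ ψ (z + t • d) := hmin (add_smul_sub_mem_Z hz hw h0.le h1)
    -- A quadratic upper bound for the squared positive part; its linear coefficient is 2δ times the
    -- multiplier, so minimality of `ψ` becomes the first-order condition for the Lagrangian at
    -- `lam`.
    have h3 : ∑ j, max (P.g ρ (z + t • d) j) 0 ^ 2 ≤ ∑ j, (max (P.g ρ z j) 0 ^ 2 +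
        t * (2 * δ) * (P.coupling d j * lam j) + t ^ 2 * P.coupling d j ^ 2) := by
      refine Finset.sum_le_sum fun j _ => ?_
      have e1 : P.g ρ (z + t • d) j = P.g ρ z j + t * P.coupling d j := by
        simp [g_eq]; ring
      have e2 : t * (2 * δ) * (P.coupling d j * lam j) =
          2 * (t * P.coupling d j) * max (P.g ρ z j) 0 := by
        simp only [lam]; field_simp
      rw [e1, e2]
      have e3 : max (P.g ρ z j + t * P.coupling d j) 0 ^ 2 ≤
          (max (P.g ρ z j) 0 + t * P.coupling d j) ^ 2 := by
        rcases le_total (P.g ρ z j + t * P.coupling d j) 0 with h | h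
        · rw [max_eq_right h, zero_pow two_ne_zero]; positivity
        · rw [max_eq_left h]
          exact pow_le_pow_left₀ h (by linarith [le_max_left (P.g ρ z j) 0]) 2
      linarith
    have h4 : inner ℝ lam (P.coupling d) = ∑ j, P.coupling d j * lam j := by
      simp [PiLp.inner_apply]
    simp only [Finset.sum_add_distrib, ← Finset.mul_sum] at h3
    rw [← h4] at h3
    have h5 := mul_le_mul_of_nonneg_left h3 (inv_nonneg.2 (by positivity : 0 ≤ 2 * δ))
    have h6 : (2 * δ)⁻¹ * (t * (2 * δ) * inner ℝ lam (P.coupling d)) =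
        t * inner ℝ lam (P.coupling d) := by field_simp
    simp only [ψ, inner_add_right, inner_smul_right, norm_add_sq_real, norm_smul,
      Real.norm_eq_abs, mul_pow, sq_abs] at h2
    simp only [dz, inner_add_left, inner_smul_left, conj_trivial, ← inner_coupling]
    linarith
  · have h1 : ∀ nu : P.Dual, P.L ρ α δ z nu = inner ℝ P.c z + α / 2 * ‖z‖ ^ 2 +
        ∑ j, (P.g ρ z j * nu j - δ / 2 * nu j ^ 2) := by
      intro nu
      rw [L, EuclideanSpace.norm_sq_eq nu, Finset.sum_sub_distrib, ← Finset.mul_sum]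
      simp [PiLp.inner_apply]
      ring
    rw [h1, h1]
    gcongr _ + ?_
    refine Finset.sum_le_sum fun j _ => ?_
    have h2 := hmu j
    have e : P.g ρ z j * lam j - δ / 2 * lam j ^ 2 = max (P.g ρ z j) 0 ^ 2 / (2 * δ) := by
      simp only [lam]
      rcases le_total (P.g ρ z j) 0 with h | h
      · simp [max_eq_right h]
      · rw [max_eq_left h]; field_simp; ring
    -- Replace g by g⁺, which only increases the product with `mu j`, and complete the square.
    rw [e, le_div_iff₀ (by positivity)]
    have h3 := mul_le_mul_of_nonneg_right (le_max_left (P.g ρ z j) 0) (mul_nonneg h2 hδ.le)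
    nlinarith [sq_nonneg (max (P.g ρ z j) 0 - δ * mu j)]

/-- Testing the saddle inequalities at `zbar` and at the zero multiplier compares the values there;
the Slater margin turns this into a bound on the full 1-norm, which dominates that of each block. -/
theorem IsSaddle.block_mem_Mblock (hα : 0 ≤ α) (hδ : 0 ≤ δ) (hZc : IsCompact P.Z)
    {zbar : P.Primal} (hslater : P.IsSlater ρ zbar) {z : P.Primal} {lam : P.Dual}
    (hs : P.IsSaddle ρ α δ z lam) (d : Fin h) : block lam d ∈ P.Mblock ρ α zbar d := by
  refine ⟨fun j => hs.2.1 ⟨d, j⟩, ?_⟩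
  have hsum : ∑ j, |block lam d j| ≤ ∑ j, |lam j| := by
    rw [Fintype.sum_sigma]
    exact Finset.single_le_sum (f := fun d => ∑ j, |lam ⟨d, j⟩|)
      (fun _ _ => Finset.sum_nonneg fun _ _ => abs_nonneg _) (Finset.mem_univ d)
  refine hsum.trans ?_
  rcases isEmpty_or_nonempty (Σ d, Fin (P.rows d)) with hE | hN
  -- Without coupling constraints the infimum is 0 by default and division by it gives 0, so both
  -- sides vanish.
  · simp [dualBound]
  have hpos : 0 < ⨅ j, -(P.g ρ zbar j) := by
    obtain ⟨j, hj⟩ := exists_eq_ciInf_of_finite (f := fun j => -(P.g ρ zbar j))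
    rw [← hj]
    exact neg_pos.2 (hslater.2 j)
  rw [dualBound, le_div_iff₀ hpos]
  have h1 := hs.2.2.1 zbar hslater.1
  have h2 := hs.2.2.2 0 fun j => le_rfl
  have h3 : inner ℝ lam (P.g ρ zbar) ≤ -((∑ j, |lam j|) * ⨅ j, -(P.g ρ zbar j)) := by
    rw [Finset.sum_mul, ← Finset.sum_neg_distrib, PiLp.inner_apply]
    refine Finset.sum_le_sum fun j _ => ?_
    have h4 := ciInf_le (Set.finite_range fun j => -(P.g ρ zbar j)).bddBelow j
    have h5 := hs.2.1 j
    rw [abs_of_nonneg h5]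
    simp only [RCLike.inner_apply, conj_trivial]
    nlinarith
  have h6 : -(‖P.c‖ * P.radius) ≤ inner ℝ P.c z := by
    have := neg_le_of_abs_le (abs_real_inner_le_norm P.c z)
    have := mul_le_mul_of_nonneg_left (norm_le_radius hZc hs.1) (norm_nonneg P.c)
    linarith
  have h7 : P.L ρ α δ z 0 = inner ℝ P.c z + α / 2 * ‖z‖ ^ 2 := by simp [L]
  have h8 : 0 ≤ α / 2 * ‖z‖ ^ 2 := by positivity
  have h9 : 0 ≤ δ / 2 * ‖lam‖ ^ 2 := by positivity
  rw [h7] at h2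
  unfold L at h1 h2
  linarith

end MILP

/-! ### Monotone stretches and the enumeration of dual update indices. -/

theorem le_of_forall_step_le {e : ℕ → ℝ} {a b : ℕ} (hab : a ≤ b)
    (h : ∀ k, a ≤ k → k < b → e (k + 1) ≤ e k) : e b ≤ e a := by
  induction b, hab using Nat.le_induction with
  | base => rfl
  | succ b hb ih =>
    exact (h b hb b.lt_succ_self).trans (ih fun k h1 h2 => h k h1 (h2.trans b.lt_succ_self))

/-- Before the first entry of `D` comes the initial index zero. -/
theorem IsNthEntry.exists_consecutive {D : Set ℕ} (hD : ∀ t ∈ D, 0 < t) {n t : ℕ}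
    (h : IsNthEntry D (n + 1) t) :
    ∃ s, ConsecutiveUpdates D s t ∧ ((n = 0 ∧ s = 0) ∨ IsNthEntry D n s) := by
  obtain ⟨ht, hn⟩ := h
  set S : Set ℕ := {s | s ∈ D ∧ s < t} with hS
  have hfin : S.Finite := (Set.finite_lt_nat t).subset fun s hs => hs.2
  have hins : {s | s ∈ D ∧ s ≤ t} = insert t S := by
    ext s
    simp only [hS, Set.mem_ofPred_eq, Set.mem_insert_iff]
    constructor
    · rintro ⟨h1, h2⟩
      rcases h2.eq_or_lt with h | h
      · exact Or.inl h
      · exact Or.inr ⟨h1, h⟩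
    · rintro (rfl | ⟨h1, h2⟩)
      · exact ⟨ht, le_rfl⟩
      · exact ⟨h1, h2.le⟩
  rw [hins, Set.ncard_insert_of_notMem (fun h => lt_irrefl t h.2) hfin] at hn
  have hcard : S.ncard = n := by omega
  rcases S.eq_empty_or_nonempty with hE | hne
  · refine ⟨0, ⟨Or.inl rfl, ht, hD t ht, fun s hs hst => ?_⟩, Or.inl ⟨?_, rfl⟩⟩
    · exact (hE ▸ (⟨hs, hst.2⟩ : s ∈ S) : s ∈ (∅ : Set ℕ))
    · rw [← hcard, hE, Set.ncard_empty]
  · obtain ⟨s, hs, hmax⟩ := S.exists_max_image id hfin hne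
    refine ⟨s, ⟨Or.inr hs.1, ht, hs.2, fun u hu hsu => ?_⟩, Or.inr ⟨hs.1, ?_⟩⟩
    · exact absurd (hmax u ⟨hu, hsu.2⟩) (not_le.2 hsu.1)
    · rw [← hcard]
      congr 1
      ext u
      exact ⟨fun hu => ⟨hu.1, hu.2.trans_lt hs.2⟩, fun hu => ⟨hu.1, hmax u hu⟩⟩

/-! ### Locality of the coupling, and the blockwise constraint sets. -/

namespace MILP

variable {m h : ℕ} {P : MILP m h}

/-- Uncoupled blocks meet only zero entries of A, so an agent's copy of them may be arbitrary. -/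
theorem block_couplingT_congr {lam mu : P.Dual} {i : Fin m}
    (hl : ∀ d, P.Coupled d i → block lam d = block mu d) :
    block (P.couplingT lam) i = block (P.couplingT mu) i := by
  ext a
  simp only [block, couplingT, Matrix.toLpLin_apply, Matrix.mulVec, dotProduct,
    Matrix.transpose_apply]
  refine Finset.sum_congr rfl fun ⟨d, e⟩ _ => ?_
  by_cases hA : P.A ⟨d, e⟩ ⟨i, a⟩ = 0
  · rw [hA, zero_mul, zero_mul]
  · congr 1
    exact congrArg (fun v => v.ofLp e) (hl d ⟨e, a, hA⟩)

theorem block_coupling_congr {z w : P.Primal} {d : Fin h}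
    (hz : ∀ l, P.Coupled d l → block z l = block w l) :
    block (P.coupling z) d = block (P.coupling w) d := by
  ext e
  simp only [block, coupling, Matrix.toLpLin_apply, Matrix.mulVec, dotProduct]
  refine Finset.sum_congr rfl fun ⟨l, a⟩ _ => ?_
  by_cases hA : P.A ⟨d, e⟩ ⟨l, a⟩ = 0
  · rw [hA, zero_mul, zero_mul]
  · congr 1
    exact congrArg (fun v => v.ofLp a) (hz l ⟨e, a, hA⟩)

theorem replaceBlock_mem_Z {z : P.Primal} (hz : z ∈ P.Z) {i : Fin m}
    {v : EuclideanSpace ℝ (Fin (P.p i) ⊕ Fin (P.q i))} (hv : v ∈ P.Zblock i) :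
    replaceBlock z i v ∈ P.Z := fun l => by
  rw [block_replaceBlock]
  rcases eq_or_ne l i with rfl | hl
  · rwa [Function.update_self]
  · rw [Function.update_of_ne hl]; exact hz l

theorem convex_Mblock (ρ : P.Dual) (α : ℝ) (zbar : P.Primal) (d : Fin h) :
    Convex ℝ (P.Mblock ρ α zbar d) := by
  intro x hx y hy a b ha hb hab
  refine ⟨fun j => ?_, ?_⟩
  · have h1 := mul_nonneg ha (hx.1 j)
    have h2 := mul_nonneg hb (hy.1 j)
    simpa using add_nonneg h1 h2
  · calc ∑ j, |(a • x + b • y) j| ≤ ∑ j, (a * |x j| + b * |y j|) := by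
          refine Finset.sum_le_sum fun j _ => ?_
          have := abs_add_le (a * x j) (b * y j)
          rw [abs_mul, abs_mul, abs_of_nonneg ha, abs_of_nonneg hb] at this
          simpa using this
      _ = a * ∑ j, |x j| + b * ∑ j, |y j| := by
          rw [Finset.sum_add_distrib, Finset.mul_sum, Finset.mul_sum]
      _ ≤ a * P.dualBound ρ α zbar + b * P.dualBound ρ α zbar :=
          add_le_add (mul_le_mul_of_nonneg_left hx.2 ha) (mul_le_mul_of_nonneg_left hy.2 hb)
      _ = P.dualBound ρ α zbar := by rw [← add_mul, hab, one_mul]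

end MILP

/-! ### Primal contraction and the dual recursion along a run. -/

namespace Trajectory.IsRun

variable {m h : ℕ} {P : MILP m h} {T : Trajectory P} {σ : Schedule m} {ρ : P.Dual}
  {zbar : P.Primal} {α δ γ β : ℝ} {B : ℕ}

theorem z_mem (hT : T.IsRun σ ρ zbar α δ γ β B) (k : ℕ) : T.z k ∈ P.Z := by
  induction k with
  | zero => exact hT.init_primal
  | succ k ih =>
    intro i
    change block (T.zP i (k + 1)) i ∈ _
    by_cases hk : k ∈ σ.K i
    · exact (hT.primal_update i k hk).1
    · rw [hT.primal_hold i k hk]; exact ih i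

/-- This is where asynchrony drops out: stale copies of other primal blocks do not enter an agent's
own gradient. -/
theorem block_dz (hT : T.IsRun σ ρ zbar α δ γ β B) (i : Fin m) (k : ℕ) :
    block (P.dz α (T.zP i k) (T.lamP i k)) i = block (P.dz α (T.z k) (T.lam k)) i := by
  change block P.c i + α • block (T.z k) i + block (P.couplingT (T.lamP i k)) i =
    block P.c i + α • block (T.z k) i + block (P.couplingT (T.lam k)) i
  rw [MILP.block_couplingT_congr (mu := T.lam k) fun d hd => hT.dual_agreement i d hd k]

theorem lam_eq_of_consecutive (hT : T.IsRun σ ρ zbar α δ γ β B) {t t' : ℕ}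
    (ht : ConsecutiveUpdates σ.D t t') {k : ℕ} (h1 : t * B ≤ k) (h2 : k < t' * B) :
    T.lam k = T.lam (t * B) := by
  induction k, h1 using Nat.le_induction with
  | base => rfl
  | succ k hk ih =>
    rw [← ih (k.lt_succ_self.trans h2)]
    ext ⟨d, e⟩
    refine congrArg (fun v => v.ofLp e) (hT.dual_hold d k fun s hs hks => ?_)
    refine ht.2.2.2 s hs ⟨?_, ?_⟩
    · exact lt_of_mul_lt_mul_right (a := B) (by omega) (Nat.zero_le _)
    · exact lt_of_mul_lt_mul_right (a := B) (by omega) (Nat.zero_le _)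

theorem norm_block_primal_step (hT : T.IsRun σ ρ zbar α δ γ β B) (hγ : 0 ≤ γ)
    (hγα : α * γ ≤ 1) {zt : P.Primal} {k : ℕ} (hzt : zt ∈ P.Z)
    (hmin : ∀ z ∈ P.Z, P.L ρ α δ zt (T.lam k) ≤ P.L ρ α δ z (T.lam k)) {i : Fin m}
    (hk : k ∈ σ.K i) :
    ‖block (T.z (k + 1) - zt) i‖ ≤ (1 - α * γ) * ‖block (T.z k - zt) i‖ := by
  have hp := hT.primal_update i k hk
  rw [MILP.gradPrimal_eq, hT.block_dz] at hp
  have h1 := hp.norm_sub_le (convex_convexHull ℝ (P.X i)) (hzt i)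
    (x' := block zt i - γ • block (P.dz α zt (T.lam k)) i) fun w hw => by
      have h2 := MILP.inner_dz_nonneg_of_isMin hzt hmin (MILP.replaceBlock_mem_Z hzt hw)
      rw [inner_sub_right, inner_replaceBlock] at h2
      have h3 := mul_nonneg hγ (by linarith :
        0 ≤ inner ℝ (block (P.dz α zt (T.lam k)) i) (w - block zt i))
      rw [sub_sub_cancel_left, inner_neg_left, inner_smul_left, conj_trivial]
      linarith
  -- Both gradients are taken at the same multiplier, so the terms in c and λ cancel and only the
  -- regularization remains.
  have h4 : block (T.zP i k) i - γ • block (P.dz α (T.z k) (T.lam k)) i -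
      (block zt i - γ • block (P.dz α zt (T.lam k)) i) =
      (1 - α * γ) • block (T.z k - zt) i := by
    ext a
    simp [block, MILP.dz, Trajectory.z, assemble]
    ring
  rw [h4, norm_smul, Real.norm_of_nonneg (by linarith)] at h1
  exact h1

/-- Every block is updated at least once in the window, gaining one factor; its other steps do not
increase the error. -/
theorem norm_primal_window (hT : T.IsRun σ ρ zbar α δ γ β B) (hσ : σ.BoundedDelays B)
    (hα : 0 ≤ α) (hγ : 0 ≤ γ) (hγα : α * γ ≤ 1) {zt : P.Primal} {lam : P.Dual}
    (hzt : zt ∈ P.Z) (hmin : ∀ z ∈ P.Z, P.L ρ α δ zt lam ≤ P.L ρ α δ z lam) {k₀ : ℕ}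
    (hlam : ∀ k, k₀ ≤ k → k < k₀ + B → T.lam k = lam) :
    ‖T.z (k₀ + B) - zt‖ ≤ (1 - α * γ) * ‖T.z k₀ - zt‖ := by
  refine norm_le_of_forall_block_le (by linarith) fun i => ?_
  have hq : 1 - α * γ ≤ 1 := by linarith [mul_nonneg hα hγ]
  let e : ℕ → ℝ := fun k => ‖block (T.z k - zt) i‖
  have hupd : ∀ k ∈ σ.K i, k₀ ≤ k → k < k₀ + B → e (k + 1) ≤ (1 - α * γ) * e k :=
    fun k hk h1 h2 => hT.norm_block_primal_step hγ hγα hzt (by rwa [hlam k h1 h2]) hk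
  have hstep : ∀ k, k₀ ≤ k → k < k₀ + B → e (k + 1) ≤ e k := fun k h1 h2 => by
    by_cases hk : k ∈ σ.K i
    · exact (hupd k hk h1 h2).trans (mul_le_of_le_one_left (norm_nonneg _) hq)
    · have : block (T.z (k + 1) - zt) i = block (T.z k - zt) i :=
        congrArg (fun v => v - block zt i) (hT.primal_hold i k hk)
      exact (congrArg norm this).le
  obtain ⟨k', hk', h1, h2⟩ := hσ.1 i k₀
  calc e (k₀ + B) ≤ e (k' + 1) :=
        le_of_forall_step_le h2 fun k h3 h4 => hstep k (by omega) h4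
    _ ≤ (1 - α * γ) * e k' := hupd k' hk' h1 h2
    _ ≤ (1 - α * γ) * e k₀ := mul_le_mul_of_nonneg_left
        (le_of_forall_step_le h1 fun k h3 h4 => hstep k h3 (by omega)) (by linarith)

theorem norm_primal_le (hT : T.IsRun σ ρ zbar α δ γ β B) (hσ : σ.BoundedDelays B)
    (hα : 0 ≤ α) (hγ : 0 ≤ γ) (hγα : α * γ ≤ 1) {t t' : ℕ}
    (ht : ConsecutiveUpdates σ.D t t') {zt : P.Primal} (hzt : zt ∈ P.Z)
    (hmin : ∀ z ∈ P.Z, P.L ρ α δ zt (T.lam (t * B)) ≤ P.L ρ α δ z (T.lam (t * B))) :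
    ‖T.z (t' * B) - zt‖ ≤ (1 - α * γ) ^ (t' - t) * ‖T.z (t * B) - zt‖ := by
  have key : ∀ n, t + n ≤ t' →
      ‖T.z ((t + n) * B) - zt‖ ≤ (1 - α * γ) ^ n * ‖T.z (t * B) - zt‖ := by
    intro n
    induction n with
    | zero => simp
    | succ n ih =>
      intro hn
      have h1 := hT.norm_primal_window hσ hα hγ hγα hzt hmin (k₀ := (t + n) * B)
        fun k h2 h3 => hT.lam_eq_of_consecutive ht
          ((Nat.mul_le_mul_right B (Nat.le_add_right t n)).trans h2)
          (h3.trans_le (by rw [← Nat.succ_mul]; exact Nat.mul_le_mul_right B hn))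
      have h4 := mul_le_mul_of_nonneg_left (ih (by omega)) (by linarith : 0 ≤ 1 - α * γ)
      rw [← add_assoc, add_mul (t + n), one_mul, pow_succ']
      linarith
  have := key (t' - t) (by have := ht.2.2.1; omega)
  rwa [Nat.add_sub_cancel' ht.2.2.1.le] at this

theorem block_g (hT : T.IsRun σ ρ zbar α δ γ β B) (d : Fin h) {t : ℕ} (ht : t ∈ σ.D) :
    block (P.g ρ (T.zD d (t * B))) d = block (P.g ρ (T.z (t * B))) d := by
  change block (P.coupling (T.zD d (t * B))) d - block P.b d + block ρ d =
    block (P.coupling (T.z (t * B))) d - block P.b d + block ρ d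
  rw [MILP.block_coupling_congr (w := T.z (t * B)) fun l hl => hT.dual_receive d l hl t ht]

/-- The saddle condition, tested by changing one block of `lamhat`, makes that block a fixed point
of the exact projected step. Blockwise nonexpansiveness then sums to the whole vector. -/
theorem norm_dual_step (hT : T.IsRun σ ρ zbar α δ γ β B) (hβ : 0 ≤ β) {zhat : P.Primal}
    {lamhat : P.Dual} (hs : P.IsSaddle ρ α δ zhat lamhat)
    (hM : ∀ d, block lamhat d ∈ P.Mblock ρ α zbar d) {t k : ℕ} (ht : t ∈ σ.D)
    (hk : k + 1 = t * B) :
    ‖T.lam (t * B) - lamhat‖ ≤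
      ‖(1 - β * δ) • (T.lam k - lamhat) + β • P.coupling (T.z (t * B) - zhat)‖ := by
  rw [← one_mul ‖(1 - β * δ) • (T.lam k - lamhat) + _‖]
  refine norm_le_of_forall_block_le zero_le_one fun d => ?_
  have hp := hT.dual_update d k t ht hk
  rw [hk, MILP.gradDual_eq] at hp
  have h1 := hp.norm_sub_le (MILP.convex_Mblock ρ α zbar d) (hM d)
    (x' := block lamhat d + β • block (P.g ρ zhat - δ • lamhat) d) fun w hw => by
      have h2 := hs.inner_dual_nonpos (mu := replaceBlock lamhat d w) fun ⟨j, e⟩ => by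
        change 0 ≤ block (replaceBlock lamhat d w) j e
        rw [block_replaceBlock]
        rcases eq_or_ne j d with rfl | hj
        · rw [Function.update_self]; exact hw.1 e
        · rw [Function.update_of_ne hj]; exact hs.2.1 ⟨j, e⟩
      rw [inner_sub_right, inner_replaceBlock] at h2
      have h3 := mul_nonneg hβ (by linarith : 0 ≤ -inner ℝ
        (block (P.g ρ zhat - δ • lamhat) d) (w - block lamhat d))
      rw [add_sub_cancel_left, inner_smul_left, conj_trivial]
      linarith
  have h4 : block (T.lamD d k) d + β • block (P.g ρ (T.zD d (t * B)) - δ • T.lamD d k) d -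
      (block lamhat d + β • block (P.g ρ zhat - δ • lamhat) d) =
      block ((1 - β * δ) • (T.lam k - lamhat) + β • P.coupling (T.z (t * B) - zhat)) d := by
    rw [← MILP.g_sub ρ]
    ext e
    have h5 := congrArg (fun v => v.ofLp e) (hT.block_g d ht)
    simp only [block] at h5
    simp [block, Trajectory.lam, assemble, h5]
    ring
  rw [h4] at h1
  rw [one_mul]
  exact h1

theorem norm_sq_dual_le (hT : T.IsRun σ ρ zbar α δ γ β B) (hσ : σ.BoundedDelays B)
    (hZne : P.Z.Nonempty) (hZc : IsCompact P.Z) (hB : 0 < B) (hα : 0 ≤ α) (hγ : 0 ≤ γ)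
    (hγα : 2 * (α * γ) ≤ 1) (hβ : 0 ≤ β) (hβδ : β * δ ≤ 1) {zhat : P.Primal} {lamhat : P.Dual}
    (hs : P.IsSaddle ρ α δ zhat lamhat) (hM : ∀ d, block lamhat d ∈ P.Mblock ρ α zbar d)
    {t t' : ℕ} (ht : ConsecutiveUpdates σ.D t t') :
    ‖T.lam (t' * B) - lamhat‖ ^ 2 ≤
      ((1 - β * δ) ^ 2 + β ^ 2) * ‖T.lam (t * B) - lamhat‖ ^ 2 +
      (4 * P.radius ^ 2 * ((1 - β * δ) ^ 2 + β ^ 2) * (1 - α * γ) ^ 2 * P.normA ^ 2 +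
        8 * P.radius ^ 2 * β ^ 2 * (1 - α * γ) * P.normA ^ 2) := by
  have htB : t * B < t' * B := Nat.mul_lt_mul_of_pos_right ht.2.2.1 hB
  have hstep := hT.norm_dual_step hβ hs hM ht.2.1 (k := t' * B - 1) (by omega)
  -- The ascent step starts from λ just before time `t' * B`, which still equals its value at `t *
  -- B`.
  rw [hT.lam_eq_of_consecutive ht (k := t' * B - 1) (by omega) (by omega)] at hstep
  obtain ⟨zt, hzt, hmin⟩ := MILP.exists_isMin (ρ := ρ) (α := α) (δ := δ) hZne hZc (T.lam (t * B))
  have hαγ : 0 ≤ α * γ := mul_nonneg hα hγ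
  set r := P.radius
  set N := P.normA
  set q := 1 - α * γ with hq
  set s := 1 - β * δ with hs_def
  set Δ := T.lam (t * B) - lamhat with hΔ
  have hr : 0 ≤ r := (norm_nonneg _).trans (MILP.norm_le_radius hZc hzt)
  have hN : 0 ≤ N := norm_nonneg _
  have hs0 : 0 ≤ s := by linarith
  have hq0 : 1 / 2 ≤ q := by linarith
  have herr : ‖T.z (t' * B) - zt‖ ≤ q * (2 * r) := by
    refine (hT.norm_primal_le hσ hα hγ (by linarith) ht hzt hmin).trans ?_
    refine mul_le_mul ?_ (MILP.norm_sub_le_radius hZc (hT.z_mem _) hzt) (norm_nonneg _)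
      (by linarith)
    -- Only one factor of the rate is kept, as the gap `t' - t` may be 1.
    exact pow_le_of_le_one (by linarith) (by linarith) (by have := ht.2.2.1; omega)
  have hAerr : ‖P.coupling (T.z (t' * B) - zt)‖ ≤ N * (q * (2 * r)) :=
    (MILP.norm_coupling_le _).trans (mul_le_mul_of_nonneg_left herr hN)
  have hAtot : ‖P.coupling (T.z (t' * B) - zhat)‖ ≤ N * (2 * r) :=
    (MILP.norm_coupling_le _).trans (mul_le_mul_of_nonneg_left
      (MILP.norm_sub_le_radius hZc (hT.z_mem _) hs.1) hN)
  have hmono : inner ℝ Δ (P.coupling (zt - zhat)) ≤ 0 := by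
    have := MILP.inner_coupling_le_of_isMin hzt hmin hs.1 hs.2.2.1
    have : 0 ≤ α * ‖zt - zhat‖ ^ 2 := by positivity
    linarith
  have hsplit : inner ℝ Δ (P.coupling (T.z (t' * B) - zhat)) =
      inner ℝ Δ (P.coupling (zt - zhat)) + inner ℝ Δ (P.coupling (T.z (t' * B) - zt)) := by
    rw [← inner_add_right, ← map_add, add_comm, sub_add_sub_cancel]
  have hcs : inner ℝ Δ (P.coupling (T.z (t' * B) - zt)) ≤ ‖Δ‖ * (N * (q * (2 * r))) :=
    (real_inner_le_norm _ _).trans (mul_le_mul_of_nonneg_left hAerr (norm_nonneg _))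
  have hexp : ‖s • Δ + β • P.coupling (T.z (t' * B) - zhat)‖ ^ 2 =
      s ^ 2 * ‖Δ‖ ^ 2 + 2 * (s * β) * inner ℝ Δ (P.coupling (T.z (t' * B) - zhat)) +
        β ^ 2 * ‖P.coupling (T.z (t' * B) - zhat)‖ ^ 2 := by
    rw [norm_add_sq_real, norm_smul, norm_smul, inner_smul_left, inner_smul_right, mul_pow,
      mul_pow, Real.norm_eq_abs, Real.norm_eq_abs, sq_abs, sq_abs, conj_trivial]
    ring
  have hcross : s * β * inner ℝ Δ (P.coupling (T.z (t' * B) - zhat)) ≤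
      s * β * (‖Δ‖ * (N * (q * (2 * r)))) :=
    mul_le_mul_of_nonneg_left (by linarith) (mul_nonneg hs0 hβ)
  -- Putting β with the dual error and 1 - βδ with the primal error produces exactly the extra β² in
  -- the rate.
  have hyoung := two_mul_le_add_sq (β * ‖Δ‖) (s * (N * (q * (2 * r))))
  have htot : β ^ 2 * ‖P.coupling (T.z (t' * B) - zhat)‖ ^ 2 ≤ β ^ 2 * (N * (2 * r)) ^ 2 :=
    mul_le_mul_of_nonneg_left (pow_le_pow_left₀ (norm_nonneg _) hAtot 2) (sq_nonneg _)
  -- Since q ≥ 1/2, q² + 2q ≥ 1; thus the 4r²β²‖A‖² from the last square fits into the β² parts of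
  -- the stated constant.
  have hrate : β ^ 2 * (N * (2 * r)) ^ 2 * 1 ≤ β ^ 2 * (N * (2 * r)) ^ 2 * (q ^ 2 + 2 * q) :=
    mul_le_mul_of_nonneg_left (by nlinarith) (by positivity)
  have hsq := pow_le_pow_left₀ (norm_nonneg _) hstep 2
  rw [hexp] at hsq
  linarith

end Trajectory.IsRun

end

/-! ### The main theorem: choice of constants and iteration of the recursion. -/

theorem theorem2 {m h : ℕ} (P : MILP m h) (ρ : P.Dual)
    (hZne : P.Z.Nonempty) (hZc : IsCompact P.Z)
    (zbar : P.Primal) (hslater : P.IsSlater ρ zbar)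
    (α : ℝ) (hα : 0 < α) (B : ℕ) (hB : 0 < B) :
    ∃ γ₁ : ℝ, 0 < γ₁ ∧ ∃ θ : ℝ, 0 < θ ∧
      ∀ γ : ℝ, 0 < γ → γ < γ₁ →
        (0 ≤ 1 - θ * γ ∧ 1 - θ * γ < 1) ∧
        ∀ δ : ℝ, 0 < δ →
          (∃! w : P.Primal × P.Dual, P.IsSaddle ρ α δ w.1 w.2) ∧
          ∀ (zhat : P.Primal) (lamhat : P.Dual), P.IsSaddle ρ α δ zhat lamhat →
          ∀ β : ℝ, 0 < β →
            β < min (2 * α / (P.normA + 2 * α * δ)) (2 * δ / (1 + δ ^ 2)) →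
            (0 ≤ (1 - β * δ) ^ 2 + β ^ 2 ∧ (1 - β * δ) ^ 2 + β ^ 2 < 1) ∧
            ∀ (σ : Schedule m) (T : Trajectory P), σ.BoundedDelays B →
              T.IsRun σ ρ zbar α δ γ β B →
              -- `1 - θ γ` is the rate of the primal iterates between dual updates
              (∀ t t' : ℕ, ConsecutiveUpdates σ.D t t' →
                ∀ zt ∈ P.Z, (∀ z ∈ P.Z, P.L ρ α δ zt (T.lam (t * B)) ≤
                    P.L ρ α δ z (T.lam (t * B))) →
                  ‖T.z (t' * B) - zt‖ ≤ (1 - θ * γ) ^ (t' - t) * ‖T.z (t * B) - zt‖) ∧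
              -- the dual iterates
              (∀ n t : ℕ, IsNthEntry σ.D n t →
                ‖T.lam (t * B) - lamhat‖ ^ 2 ≤
                  ((1 - β * δ) ^ 2 + β ^ 2) ^ n * ‖T.lam 0 - lamhat‖ ^ 2 +
                  (4 * P.radius ^ 2 * ((1 - β * δ) ^ 2 + β ^ 2) * (1 - θ * γ) ^ 2 * P.normA ^ 2 +
                    8 * P.radius ^ 2 * β ^ 2 * (1 - θ * γ) * P.normA ^ 2) *
                  ∑ i ∈ Finset.range (n + 1), ((1 - β * δ) ^ 2 + β ^ 2) ^ i) := by
  -- The bound 1/(2α) keeps the primal rate above 1/2, as the error constant in `norm_sq_dual_le`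
  -- requires; contraction alone would allow 1/α.
  refine ⟨1 / (2 * α), by positivity, α, hα, fun γ hγ hγ₁ => ?_⟩
  rw [lt_div_iff₀ (by positivity)] at hγ₁
  have hαγ : 0 < α * γ := mul_pos hα hγ
  refine ⟨⟨by linarith, by linarith⟩, fun δ hδ => ⟨?_, fun zhat lamhat hs β hβ hβlt => ?_⟩⟩
  · obtain ⟨z, lam, hs⟩ := MILP.exists_isSaddle (ρ := ρ) hα hδ hZne hZc
    refine ⟨(z, lam), hs, fun w hw => ?_⟩
    obtain ⟨h1, h2⟩ := MILP.IsSaddle.eq hα hδ hw hs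
    exact Prod.ext h1 h2
  have hN : 0 ≤ P.normA := norm_nonneg _
  have hβ1 := hβlt.trans_le (min_le_left _ _)
  have hβ2 := hβlt.trans_le (min_le_right _ _)
  rw [lt_div_iff₀ (by positivity)] at hβ1 hβ2
  -- The first bound on β makes 1 - βδ nonnegative; the second gives `hqd`, since the rate is 1 +
  -- β(β(1 + δ²) - 2δ).
  have hβδ : β * δ ≤ 1 := by
    have : 2 * α * (β * δ) ≤ 2 * α * 1 := by linarith [mul_nonneg hβ.le hN]
    exact le_of_mul_le_mul_left this (by positivity)
  have hqd : (1 - β * δ) ^ 2 + β ^ 2 < 1 := by nlinarith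
  refine ⟨⟨by positivity, hqd⟩, fun σ T hσ hT => ⟨fun t t' ht zt hzt hmin =>
    hT.norm_primal_le hσ hα.le hγ.le (by linarith) ht hzt hmin, ?_⟩⟩
  have hM := hs.block_mem_Mblock hα.le hδ.le hZc hslater
  have hrec := fun t t' (ht : ConsecutiveUpdates σ.D t t') =>
    hT.norm_sq_dual_le hσ hZne hZc hB hα.le hγ.le (by linarith) hβ.le hβδ hs hM ht
  set qd := (1 - β * δ) ^ 2 + β ^ 2
  set C := 4 * P.radius ^ 2 * qd * (1 - α * γ) ^ 2 * P.normA ^ 2 +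
    8 * P.radius ^ 2 * β ^ 2 * (1 - α * γ) * P.normA ^ 2
  have hqd0 : 0 ≤ qd := by positivity
  have hC : 0 ≤ C := by
    have : 0 ≤ 1 - α * γ := by linarith
    positivity
  -- The induction starts at time 0, which is not an entry of D, hence the extra alternative for n =
  -- 0.
  have key : ∀ n t : ℕ, (n = 0 ∧ t = 0) ∨ IsNthEntry σ.D n t →
      ‖T.lam (t * B) - lamhat‖ ^ 2 ≤
        qd ^ n * ‖T.lam 0 - lamhat‖ ^ 2 + C * ∑ i ∈ Finset.range (n + 1), qd ^ i := by
    intro n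
    induction n with
    | zero =>
      rintro t (⟨-, rfl⟩ | ⟨ht, hn⟩)
      · simpa using hC
      -- Finiteness is needed because `ncard` is also 0 for infinite sets.
      · have hfin : {s | s ∈ σ.D ∧ s ≤ t}.Finite := (Set.finite_le_nat t).subset fun s hs => hs.2
        rw [Set.ncard_eq_zero hfin] at hn
        exact absurd (hn ▸ (⟨ht, le_rfl⟩ : t ∈ {s | s ∈ σ.D ∧ s ≤ t})) (Set.notMem_empty t)
    | succ n ih =>
      rintro t (⟨h0, -⟩ | ht)
      · exact absurd h0 n.succ_ne_zero
      obtain ⟨s, hst, hs⟩ := ht.exists_consecutive σ.D_pos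
      have h1 := hrec s t hst
      have h2 := mul_le_mul_of_nonneg_left (ih s hs) hqd0
      have h3 : ∑ i ∈ Finset.range (n + 1 + 1), qd ^ i =
          qd * ∑ i ∈ Finset.range (n + 1), qd ^ i + 1 := by
        rw [Finset.sum_range_succ', Finset.mul_sum, pow_zero]
        simp only [pow_succ']
      rw [h3, pow_succ' qd n]
      linarith
  exact fun n t ht => key n t (Or.inr ht)
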